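/- Let $R$ be a commutative ring, and let $\mathrm{FI}$ be the category of finite sets and injective maps. An $\mathrm{FI}$-module over $R$ is a functor $V$ from $\mathrm{FI}$ to the category of $R$-modules. It is finitely generated if there are finitely many elements $w_i\in V([n_i])$, where $[n]=\{1,\dots,n\}$, such that for every finite set $X$ the $R$-module $V(X)$ is spanned by the elements $\alpha(w_i)$ with $\alpha:[n_i]\to X$ injective. The degree of $V$ is $\deg(V)=\sup\{n\in\mathbb N : V([n])\neq 0\}\in\{-\infty\}\cup\mathbb N\cup\{\infty\}$, where $\sup\emptyset=-\infty$. For a finite set $I$, let $RI$ be the free $R$-module with basis $I$ and $\det(I)=\bigwedge^{|I|}RI$. For an $\mathrm{FI}$-module $V$, let $\widetilde S_{-*}V$ be the complex of $\mathrm{FI}$-modules $\cdots\to\widetilde S_{-2}V\to\widetilde S_{-1}V\to\widetilde S_0V\to 0$ with $$(\widetilde S_{-a}V)(X)=\bigoplus_{I\subset X,\ |I|=a}V(X\setminus I)\otimes_R\det(I)\qquad(a\in\mathbb N),$$ on which an injective map $\alpha:X\to X'$ acts by $\alpha(v\otimes i_1\wedge\cdots\wedge i_a)=\alpha(v)\otimes\alpha(i_1)\wedge\cdots\wedge\alpha(i_a)$,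 and whose differential is $$d(v\otimes i_1\wedge\cdots\wedge i_a)=\sum_{p=1}^a(-1)^p\,i_p(v)\otimes i_1\wedge\cdots\widehat{i_p}\cdots\wedge i_a$$ for $I=\{i_1,\dots,i_a\}$ and $v\in V(X\setminus I)$, where $i_p(v)$ is the image of $v$ under the map induced by the inclusion $X\setminus I\subset (X\setminus I)\cup\{i_p\}$. Let $H_a(\widetilde S_{-*}V)$, an $\mathrm{FI}$-module, be its homology at $\widetilde S_{-a}V$. **Corollary.** If $R$ is noetherian and $V$ is a finitely generated $\mathrm{FI}$-module over $R$, then $\deg\big(H_a(\widetilde S_{-*}V)\big)<\infty$ for every $a\in\mathbb N$. -/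

import Mathlib

open CategoryTheory
open scoped TensorProduct DirectSum

universe u

/-- Finite sets: the objects of the category `FI`. -/
structure FI : Type 1 where
  /-- the underlying set -/
  carrier : Type
  [finite : Finite carrier]

namespace FI

instance : CoeSort FI Type := ⟨FI.carrier⟩

instance (X : FI) : Finite X := X.finite

noncomputable instance (X : FI) : DecidableEq X := Classical.decEq _

/-- The category of finite sets and injective maps. -/
instance : Category.{0} FI where
  Hom X Y := X ↪ Y
  id X := Function.Embedding.refl X
  comp f g := Function.Embedding.trans f g

/-- The injective map underlying a morphism of `FI`. -/
def emb {X Y : FI} (f : X ⟶ Y) : X ↪ Y := f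

/-- The morphism of `FI` given by an injective map. -/
def ofEmb {X Y : FI} (f : X ↪ Y) : X ⟶ Y := f

@[simp] lemma emb_ofEmb {X Y : FI} (f : X ↪ Y) : emb (ofEmb f) = f := rfl

@[simp] lemma emb_id (X : FI) : emb (𝟙 X) = Function.Embedding.refl X := rfl

@[simp] lemma emb_comp {X Y Z : FI} (f : X ⟶ Y) (g : Y ⟶ Z) :
    emb (f ≫ g) = (emb f).trans (emb g) := rfl

lemma hom_ext {X Y : FI} {f g : X ⟶ Y} (h : ∀ x, emb f x = emb g x) : f = g :=
  Function.Embedding.ext h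

/-- The set `[n]` with `n` elements. -/
def std (n : ℕ) : FI := ⟨Fin n⟩

/-- The complement `X \ I`. -/
def compl (X : FI) (I : Finset X) : FI := ⟨{x : X // x ∉ I}⟩

/-- If `α : X → Y` is injective and every point outside `I` is sent outside `J`, the restriction
`X \ I → Y \ J` of `α`. -/
def complMap {X Y : FI} (α : X ⟶ Y) {I : Finset X} {J : Finset Y}
    (h : ∀ x, x ∉ I → emb α x ∉ J) : X.compl I ⟶ Y.compl J :=
  ofEmb ⟨fun x => ⟨emb α x.1, h x.1 x.2⟩,
    fun _ _ e => Subtype.ext ((emb α).injective (congrArg Subtype.val e))⟩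

lemma complMap_comp {X Y Z : FI} (α : X ⟶ Y) (β : Y ⟶ Z) {I : Finset X} {J : Finset Y}
    {K : Finset Z} (h : ∀ x, x ∉ I → emb α x ∉ J) (h' : ∀ x, x ∉ J → emb β x ∉ K) :
    complMap α h ≫ complMap β h' =
      complMap (α ≫ β) (fun x hx => h' _ (h x hx)) := rfl

lemma complMap_id {X : FI} {I : Finset X} (h : ∀ x, x ∉ I → emb (𝟙 X) x ∉ I) :
    complMap (𝟙 X) h = 𝟙 (X.compl I) := rfl

end FI

/-- An `FI`-module over `R`: a functor from `FI` to `R`-modules. -/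
abbrev FIModule (R : Type u) [CommRing R] := FI ⥤ ModuleCat.{u} R

namespace FIModule

variable {R : Type u} [CommRing R]

/-- `V` is finitely generated: there are finitely many elements `w i ∈ V([n i])` such that each
`V(X)` is spanned by the elements `α (w i)`, for `α : [n i] → X` injective. -/
def FinitelyGenerated (V : FIModule R) : Prop :=
  ∃ (k : ℕ) (n : Fin k → ℕ) (w : ∀ i, V.obj (FI.std (n i))),
    ∀ X : FI, Submodule.span R
      {x : V.obj X | ∃ (i : Fin k) (α : FI.std (n i) ⟶ X), (V.map α).hom (w i) = x} = ⊤

/-- The degree `sup {n ∈ ℕ | V([n]) ≠ 0}` of an `FI`-module, in `{-∞} ∪ ℕ ∪ {∞}`; the supremum of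
the empty set is `-∞ = ⊥`. -/
noncomputable def degree (V : FIModule R) : WithBot ℕ∞ :=
  sSup {d | ∃ n : ℕ, Nontrivial (V.obj (FI.std n)) ∧ d = ((n : ℕ∞) : WithBot ℕ∞)}

/-- The linear map `V(X) → V(Y)` induced by an injection. -/
abbrev act (V : FIModule R) {X Y : FI} (α : X ⟶ Y) : V.obj X →ₗ[R] V.obj Y := (V.map α).hom

lemma act_act (V : FIModule R) {X Y Z : FI} (α : X ⟶ Y) (β : Y ⟶ Z) (v : V.obj X) :
    V.act β (V.act α v) = V.act (α ≫ β) v := by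
  simp [act]

/-- The subsets of `X` with `a` elements. -/
abbrev Subsets (X : FI) (a : ℕ) := {I : Finset X // I.card = a}

variable (R) in
/-- `det I`, the top exterior power `⋀^|I| (R I)` of the free module on `I`. -/
abbrev Det {X : FI} {a : ℕ} (I : Subsets X a) : Type u := ⋀[R]^a (I.1 →₀ R)

/-- The underlying module of `(S̃_{-a} V)(X)`, the direct sum over the subsets `I` of `X` with
`a` elements of the modules `V(X \ I) ⊗ det I`. -/
abbrev KoszulObj (V : FIModule R) (a : ℕ) (X : FI) : Type u :=
  ⨁ I : Subsets X a, V.obj (X.compl I.1) ⊗[R] Det R I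

/-- The inclusion of the summand `V(X \ I) ⊗ det I`. -/
noncomputable abbrev incl (V : FIModule R) {a : ℕ} {X : FI} (I : Subsets X a) :
    V.obj (X.compl I.1) ⊗[R] Det R I →ₗ[R] KoszulObj V a X :=
  DirectSum.lof R (Subsets X a) (fun I => V.obj (X.compl I.1) ⊗[R] Det R I) I

lemma koszulObj_ext (V : FIModule R) {a : ℕ} {X : FI} {N : Type*} [AddCommGroup N] [Module R N]
    {f g : KoszulObj V a X →ₗ[R] N}
    (h : ∀ (I : Subsets X a) (v : V.obj (X.compl I.1)) (w : Fin a → (I.1 →₀ R)),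
      f (incl V I (v ⊗ₜ exteriorPower.ιMulti R a w)) =
        g (incl V I (v ⊗ₜ exteriorPower.ιMulti R a w))) : f = g := by
  refine DirectSum.linearMap_ext R fun I => TensorProduct.ext' fun v x => ?_
  have : (f ∘ₗ incl V I ∘ₗ TensorProduct.mk R _ _ v) =
      (g ∘ₗ incl V I ∘ₗ TensorProduct.mk R _ _ v) := by
    refine exteriorPower.linearMap_ext ?_
    ext w
    exact h I v w
  exact LinearMap.congr_fun this x

/-! ### Functoriality of the terms -/

/-- The image of `I` under an injection. -/
def Subsets.map {X Y : FI} (α : X ⟶ Y) {a : ℕ} (I : Subsets X a) : Subsets Y a :=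
  ⟨I.1.map (FI.emb α), by rw [Finset.card_map, I.2]⟩

lemma Subsets.emb_mem_map {X Y : FI} (α : X ⟶ Y) {a : ℕ} (I : Subsets X a) {x : X} :
    FI.emb α x ∈ (I.map α).1 ↔ x ∈ I.1 :=
  Finset.mem_map' _

/-- The map `R I → R J` induced by an injection `α` with `α(I) ⊆ J`. -/
noncomputable def freeMap (R : Type u) [CommRing R] {X Y : FI} (α : X ⟶ Y) {I : Finset X}
    {J : Finset Y} (h : ∀ x ∈ I, FI.emb α x ∈ J) : (I →₀ R) →ₗ[R] (J →₀ R) :=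
  Finsupp.lmapDomain R R fun x => ⟨FI.emb α x.1, h x.1 x.2⟩

/-- The map `(S̃_{-a} V)(X) → (S̃_{-a} V)(Y)` induced by an injection `α : X → Y`. It sends
`v ⊗ (i₁ ∧ ⋯ ∧ i_a)` in the summand of `I` to `α(v) ⊗ (α(i₁) ∧ ⋯ ∧ α(i_a))` in the summand
of `α(I)`. -/
noncomputable def koszulMap (V : FIModule R) (a : ℕ) {X Y : FI} (α : X ⟶ Y) :
    KoszulObj V a X →ₗ[R] KoszulObj V a Y :=
  DirectSum.toModule R _ _ fun I =>
    incl V (I.map α) ∘ₗ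
      TensorProduct.map
        (V.act (FI.complMap α fun _ hx => (I.emb_mem_map α).not.2 hx))
        (exteriorPower.map a (freeMap R α fun _ hx => (I.emb_mem_map α).2 hx))

/-! ### The differential -/

/-- `I \ {i}`. -/
noncomputable def Subsets.erase {X : FI} {a : ℕ} (I : Subsets X (a + 1)) (i : I.1) : Subsets X a :=
  ⟨I.1.erase i, by rw [Finset.card_erase_of_mem i.2, I.2, Nat.add_sub_cancel]⟩

lemma Subsets.erase_subset {X : FI} {a : ℕ} (I : Subsets X (a + 1)) (i : I.1) :
    (I.erase i).1 ⊆ I.1 := Finset.erase_subset _ _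

/-- For `J ⊆ I`, the map `V(X \ I) → V(X \ J)` induced by the inclusion. -/
noncomputable def actIncl (V : FIModule R) {X : FI} {I J : Finset X} (h : J ⊆ I) :
    V.obj (X.compl I) →ₗ[R] V.obj (X.compl J) :=
  V.act (FI.complMap (𝟙 X) fun _ hx hJ => hx (h hJ))

/-- For `J ⊆ I`, the projection `R I → R J` killing the basis elements not in `J`. -/
noncomputable def freeProj (R : Type u) [CommRing R] {X : FI} {I J : Finset X} (h : J ⊆ I) :
    (I →₀ R) →ₗ[R] (J →₀ R) :=
  Finsupp.lcomapDomain (fun j : J => (⟨j.1, h j.2⟩ : I))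
    fun _ _ e => Subtype.ext (congrArg (fun x : I => x.1) e)

/-- The map `det I → det (I \ {i})` sending `i₁ ∧ ⋯ ∧ i_a`, where `i = i_p`, to
`(-1)^p i₁ ∧ ⋯ ∧ î_p ∧ ⋯ ∧ i_a` (here `p` counts from `1`). For arbitrary vectors,
`w₁ ∧ ⋯ ∧ w_a` is sent to the sum over `p` of `(-1)^p` times the `i`-th coordinate of `w_p` times
the wedge product of the remaining vectors, projected to `R (I \ {i})`. -/
noncomputable def contract (R : Type u) [CommRing R] {X : FI} {a : ℕ} (I : Subsets X (a + 1))
    (i : I.1) : Det R I →ₗ[R] Det R (I.erase i) :=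
  -exteriorPower.alternatingMapLinearEquiv (AlternatingMap.alternatizeUncurryFin
    ((Finsupp.lapply i).smulRight
      ((exteriorPower.ιMulti R a).compLinearMap (freeProj R (I.erase_subset i)))))

/-- The differential `d : (S̃_{-(a+1)} V)(X) → (S̃_{-a} V)(X)`. -/
noncomputable def koszulD (V : FIModule R) (a : ℕ) (X : FI) :
    KoszulObj V (a + 1) X →ₗ[R] KoszulObj V a X :=
  DirectSum.toModule R _ _ fun I =>
    ∑ i : I.1, incl V (I.erase i) ∘ₗ
      TensorProduct.map (V.actIncl (I.erase_subset i)) (contract R I i)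

lemma koszulMap_incl (V : FIModule R) {a : ℕ} {X Y : FI} (α : X ⟶ Y) (I : Subsets X a)
    (v : V.obj (X.compl I.1)) (w : Fin a → (I.1 →₀ R)) :
    koszulMap V a α (incl V I (v ⊗ₜ exteriorPower.ιMulti R a w)) =
      incl V (I.map α) (V.act (FI.complMap α fun _ hx => (I.emb_mem_map α).not.2 hx) v ⊗ₜ
        exteriorPower.ιMulti R a fun p =>
          freeMap R α (fun _ hx => (I.emb_mem_map α).2 hx) (w p)) := by
  simp [koszulMap, incl, Function.comp_def]

lemma contract_ιMulti {X : FI} {a : ℕ} (I : Subsets X (a + 1)) (i : I.1)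
    (w : Fin (a + 1) → (I.1 →₀ R)) :
    contract R I i (exteriorPower.ιMulti R (a + 1) w) =
      ∑ p : Fin (a + 1), (-1 : R) ^ (p.1 + 1) • w p i •
        exteriorPower.ιMulti R a
          fun q => freeProj R (I.erase_subset i) (p.removeNth w q) := by
  rw [contract, LinearMap.neg_apply, exteriorPower.alternatingMapLinearEquiv_apply_ιMulti,
    AlternatingMap.alternatizeUncurryFin_apply, ← Finset.sum_neg_distrib]
  refine Finset.sum_congr rfl fun p _ => ?_
  rcases Nat.even_or_odd p.1 with hp | hp
  · simp [pow_succ, hp.neg_one_pow, AlternatingMap.compLinearMap_apply]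
    rfl
  · simp [pow_succ, hp.neg_one_pow, AlternatingMap.compLinearMap_apply]

lemma koszulD_incl (V : FIModule R) {a : ℕ} {X : FI} (I : Subsets X (a + 1))
    (v : V.obj (X.compl I.1)) (x : Det R I) :
    koszulD V a X (incl V I (v ⊗ₜ x)) =
      ∑ i : I.1, incl V (I.erase i) (V.actIncl (I.erase_subset i) v ⊗ₜ contract R I i x) := by
  simp [koszulD, incl]

lemma freeProj_single {X : FI} {I J : Finset X} (h : J ⊆ I) (x : I) (hx : x.1 ∈ J) :
    freeProj R h (Finsupp.single x 1) = Finsupp.single ⟨x.1, hx⟩ 1 := by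
  ext j
  simp only [freeProj, Finsupp.lcomapDomain, LinearMap.coe_mk, AddHom.coe_mk,
    Finsupp.comapDomain_apply, Finsupp.single_apply, Subtype.ext_iff]

/-- The defining formula of the differential: if `I = {i₁, …, i_{a+1}}`, then
`d (v ⊗ i₁ ∧ ⋯ ∧ i_{a+1}) = ∑ₚ (-1)^p i_p(v) ⊗ i₁ ∧ ⋯ ∧ î_p ∧ ⋯ ∧ i_{a+1}`, where the exponent
is `p + 1` below because `Fin (a + 1)` counts from `0`. -/
theorem koszulD_apply (V : FIModule R) {a : ℕ} {X : FI} (I : Subsets X (a + 1))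
    (v : V.obj (X.compl I.1)) (i : Fin (a + 1) ≃ I.1) :
    koszulD V a X (incl V I (v ⊗ₜ
        exteriorPower.ιMulti R (a + 1) fun p => Finsupp.single (i p) 1)) =
      ∑ p : Fin (a + 1), (-1 : R) ^ (p.1 + 1) •
        incl V (I.erase (i p)) (V.actIncl (I.erase_subset (i p)) v ⊗ₜ
          exteriorPower.ιMulti R a fun q => Finsupp.single
            (⟨(i (p.succAbove q)).1, Finset.mem_erase.2
              ⟨fun e => p.succAbove_ne q (i.injective (Subtype.ext e)),
                (i (p.succAbove q)).2⟩⟩ : (I.erase (i p)).1) 1) := by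
  rw [koszulD_incl, ← i.sum_comp]
  refine Finset.sum_congr rfl fun p _ => ?_
  rw [contract_ιMulti, Finset.sum_eq_single p]
  · rw [Finsupp.single_eq_same, one_smul, TensorProduct.tmul_smul, map_smul]
    congr 4
    funext q
    exact freeProj_single _ _ _
  · intro q _ hq
    rw [Finsupp.single_apply, if_neg (fun e => hq (i.injective e)), zero_smul, smul_zero]
  · simp

/-! ### The complex -/

@[simp] lemma freeProj_apply {X : FI} {I J : Finset X} (h : J ⊆ I) (w : I →₀ R) (j : J) :
    freeProj R h w j = w ⟨j.1, h j.2⟩ := rfl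

lemma freeMap_apply {X Y : FI} (α : X ⟶ Y) {I : Finset X} {J : Finset Y}
    (h : ∀ x ∈ I, FI.emb α x ∈ J) (w : I →₀ R) (x : X) (hx : x ∈ I) :
    freeMap R α h w ⟨FI.emb α x, h x hx⟩ = w ⟨x, hx⟩ :=
  Finsupp.mapDomain_apply (f := fun x : I => (⟨FI.emb α x.1, h x.1 x.2⟩ : J))
    (fun _ _ e => Subtype.ext ((FI.emb α).injective (congrArg Subtype.val e))) w ⟨x, hx⟩

lemma incl_congr (V : FIModule R) {a : ℕ} {X : FI} {I J : Subsets X a} (h : I = J)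
    {v : V.obj (X.compl I.1)} {v' : V.obj (X.compl J.1)}
    {w : Fin a → (I.1 →₀ R)} {w' : Fin a → (J.1 →₀ R)}
    (hv : V.act (FI.complMap (𝟙 X) fun x (hx : x ∉ I.1) => by rw [← h]; exact hx) v = v')
    (hw : ∀ p x (hx : x ∈ I.1), w p ⟨x, hx⟩ = w' p ⟨x, by rw [← h]; exact hx⟩) :
    incl V I (v ⊗ₜ exteriorPower.ιMulti R a w) = incl V J (v' ⊗ₜ exteriorPower.ιMulti R a w') := by
  subst h
  have e : w = w' := by
    funext p
    ext x
    exact hw p x.1 x.2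
  subst e hv
  rw [FI.complMap_id]
  simp [act]

lemma koszulMap_id (V : FIModule R) (a : ℕ) (X : FI) :
    koszulMap V a (𝟙 X) = LinearMap.id := by
  refine koszulObj_ext V fun I v w => ?_
  rw [koszulMap_incl, LinearMap.id_apply]
  symm
  refine incl_congr V (Subtype.ext (Finset.map_refl).symm) rfl fun p x hx => ?_
  exact (freeMap_apply (𝟙 X) _ (w p) x hx).symm

lemma koszulMap_comp (V : FIModule R) (a : ℕ) {X Y Z : FI} (α : X ⟶ Y) (β : Y ⟶ Z) :
    koszulMap V a (α ≫ β) = koszulMap V a β ∘ₗ koszulMap V a α := by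
  refine koszulObj_ext V fun I v w => ?_
  rw [LinearMap.comp_apply, koszulMap_incl, koszulMap_incl, koszulMap_incl]
  refine incl_congr V (Subtype.ext (Finset.map_map _ _ _).symm) ?_ fun p z hz => ?_
  · rw [act_act, act_act, FI.complMap_comp, FI.complMap_comp]
    rfl
  · obtain ⟨x, hx, rfl⟩ := Finset.mem_map.1 hz
    refine (freeMap_apply (α ≫ β) _ (w p) x hx).trans ?_
    refine Eq.trans ?_ (freeMap_apply β _ (freeMap R α _ (w p)) (FI.emb α x)
      ((I.emb_mem_map α).2 hx)).symm
    exact (freeMap_apply α _ (w p) x hx).symm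

lemma koszulD_incl_ιMulti (V : FIModule R) {a : ℕ} {X : FI} (I : Subsets X (a + 1))
    (v : V.obj (X.compl I.1)) (w : Fin (a + 1) → (I.1 →₀ R)) :
    koszulD V a X (incl V I (v ⊗ₜ exteriorPower.ιMulti R (a + 1) w)) =
      ∑ i : I.1, ∑ p : Fin (a + 1), (-1 : R) ^ (p.1 + 1) • w p i •
        incl V (I.erase i) (V.actIncl (I.erase_subset i) v ⊗ₜ exteriorPower.ιMulti R a
          fun q => freeProj R (I.erase_subset i) (p.removeNth w q)) := by
  rw [koszulD_incl]
  refine Finset.sum_congr rfl fun i _ => ?_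
  rw [contract_ιMulti, TensorProduct.tmul_sum, map_sum]
  simp only [TensorProduct.tmul_smul, map_smul]

lemma koszulD_naturality (V : FIModule R) (a : ℕ) {X Y : FI} (α : X ⟶ Y) :
    koszulD V a Y ∘ₗ koszulMap V (a + 1) α = koszulMap V a α ∘ₗ koszulD V a X := by
  refine koszulObj_ext V fun I v w => ?_
  rw [LinearMap.comp_apply, LinearMap.comp_apply, koszulMap_incl, koszulD_incl_ιMulti,
    koszulD_incl_ιMulti]
  simp only [map_sum, map_smul, koszulMap_incl]
  let e : I.1 ≃ (I.map α).1 := Equiv.ofBijective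
    (fun x => ⟨FI.emb α x.1, (I.emb_mem_map α).2 x.2⟩)
    ⟨fun _ _ e => Subtype.ext ((FI.emb α).injective (congrArg Subtype.val e)), fun y => by
      obtain ⟨x, hx, h⟩ := Finset.mem_map.1 y.2
      exact ⟨⟨x, hx⟩, Subtype.ext h⟩⟩
  rw [← e.sum_comp]
  refine Finset.sum_congr rfl fun i _ => Finset.sum_congr rfl fun p _ => ?_
  have hmap : (I.map α).erase (e i) = (I.erase i).map α :=
    Subtype.ext (Finset.map_erase (FI.emb α) I.1 i.1).symm
  congr 1
  congr 1
  · exact freeMap_apply α _ (w p) i.1 i.2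
  · refine incl_congr V hmap ?_ fun q y hy => ?_
    · rw [actIncl, actIncl, act_act, act_act, act_act]
      rfl
    · obtain ⟨x, hx, rfl⟩ := Finset.mem_map.1 (Finset.mem_of_mem_erase hy)
      have hxi : x ∈ (I.erase i).1 := by
        refine Finset.mem_erase.2 ⟨fun h => ?_, hx⟩
        subst h
        exact (Finset.mem_erase.1 hy).1 rfl
      rw [freeProj_apply]
      refine (freeMap_apply α _ _ x hx).trans ?_
      exact (freeMap_apply α _ (freeProj R (I.erase_subset i) _) x hxi).symm

/-- The alternating map `u ↦ ji(v) ⊗ u₁ ∧ ⋯ ∧ u_a` into the summand of `I \ {i, j}`. -/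
noncomputable def doubleTerm (V : FIModule R) {a : ℕ} {X : FI} (I : Subsets X (a + 2))
    (v : V.obj (X.compl I.1)) (i : I.1) (j : (I.erase i).1) :
    (I.1 →₀ R) [⋀^Fin a]→ₗ[R] KoszulObj V a X :=
  (incl V ((I.erase i).erase j) ∘ₗ TensorProduct.mk R _ _
    (V.actIncl ((I.erase i).erase_subset j) (V.actIncl (I.erase_subset i) v))).compAlternatingMap
    ((exteriorPower.ιMulti R a).compLinearMap
      (freeProj R ((I.erase i).erase_subset j) ∘ₗ freeProj R (I.erase_subset i)))

lemma doubleTerm_symm (V : FIModule R) {a : ℕ} {X : FI} (I : Subsets X (a + 2))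
    (v : V.obj (X.compl I.1)) (i j : I.1) (hj : j.1 ∈ (I.erase i).1) (hi : i.1 ∈ (I.erase j).1) :
    doubleTerm V I v i ⟨j.1, hj⟩ = doubleTerm V I v j ⟨i.1, hi⟩ := by
  have h : (I.erase i).erase ⟨j.1, hj⟩ = (I.erase j).erase ⟨i.1, hi⟩ :=
    Subtype.ext (Finset.erase_right_comm (s := I.1) (a := i.1) (b := j.1))
  refine AlternatingMap.ext fun u => ?_
  refine incl_congr V h
    (w := fun q => freeProj R ((I.erase i).erase_subset ⟨j.1, hj⟩)
      (freeProj R (I.erase_subset i) (u q)))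
    (w' := fun q => freeProj R ((I.erase j).erase_subset ⟨i.1, hi⟩)
      (freeProj R (I.erase_subset j) (u q))) ?_ fun q x hx => rfl
  rw [actIncl, actIncl, actIncl, actIncl, act_act, act_act, act_act]
  rfl

lemma koszulD_koszulD (V : FIModule R) (a : ℕ) (X : FI) :
    koszulD V a X ∘ₗ koszulD V (a + 1) X = 0 := by
  refine koszulObj_ext V fun I v w => ?_
  let f : (I.1 →₀ R) →ₗ[R] (I.1 →₀ R) →ₗ[R] (I.1 →₀ R) [⋀^Fin a]→ₗ[R] KoszulObj V a X :=
    ∑ i : I.1, ∑ j : (I.erase i).1, (Finsupp.lapply i).smulRight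
      ((Finsupp.lapply ⟨j.1, I.erase_subset i j.2⟩).smulRight (doubleTerm V I v i j))
  have hf (x y) : f x y = ∑ i : I.1, ∑ j : (I.erase i).1,
      x i • y ⟨j.1, I.erase_subset i j.2⟩ • doubleTerm V I v i j := by
    simp [f, LinearMap.sum_apply]
  have hsymm : ∀ x y, f x y = f y x := by
    intro x y
    rw [hf, hf, Finset.sum_sigma', Finset.sum_sigma']
    have key (i : I.1) (j : (I.erase i).1) : i.1 ∈ (I.erase ⟨j.1, I.erase_subset i j.2⟩).1 :=
      Finset.mem_erase.2 ⟨fun h => (Finset.mem_erase.1 j.2).1 h.symm, i.2⟩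
    refine Finset.sum_bij' (fun s _ => ⟨⟨s.2.1, I.erase_subset s.1 s.2.2⟩, ⟨s.1.1, key s.1 s.2⟩⟩)
      (fun s _ => ⟨⟨s.2.1, I.erase_subset s.1 s.2.2⟩, ⟨s.1.1, key s.1 s.2⟩⟩)
      (fun _ _ => Finset.mem_sigma.2 ⟨Finset.mem_univ _, Finset.mem_univ _⟩)
      (fun _ _ => Finset.mem_sigma.2 ⟨Finset.mem_univ _, Finset.mem_univ _⟩)
      (fun _ _ => rfl) (fun _ _ => rfl) (fun s _ => ?_)
    rw [smul_comm]
    congr 2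
    exact doubleTerm_symm V I v s.1 ⟨s.2.1, I.erase_subset s.1 s.2.2⟩ s.2.2 (key s.1 s.2)
  have h0 := congrArg (fun g => g w)
    (AlternatingMap.alternatizeUncurryFin_alternatizeUncurryFinLM_comp_of_symmetric hsymm)
  rw [LinearMap.comp_apply, koszulD_incl_ιMulti, LinearMap.zero_apply]
  refine Eq.trans ?_ h0
  simp only [map_sum, map_smul, koszulD_incl_ιMulti, AlternatingMap.alternatizeUncurryFin_apply,
    LinearMap.comp_apply, AlternatingMap.alternatizeUncurryFinLM_apply, hf]
  have asum : ∀ {ι : Type} [Fintype ι]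
      (g : ι → (I.1 →₀ R) [⋀^Fin a]→ₗ[R] KoszulObj V a X) (u : Fin a → (I.1 →₀ R)),
      (∑ i, g i) u = ∑ i, g i u := fun {ι} _ g u =>
    map_sum (AddMonoidHom.mk' (fun h : (I.1 →₀ R) [⋀^Fin a]→ₗ[R] KoszulObj V a X => h u)
      fun _ _ => rfl) g Finset.univ
  simp only [asum, AlternatingMap.smul_apply, Finset.smul_sum]
  rw [Finset.sum_comm]
  refine Finset.sum_congr rfl fun p _ => ?_
  rw [Finset.sum_comm (s := (Finset.univ : Finset (Fin (a + 1))))]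
  refine Finset.sum_congr rfl fun i _ => ?_
  rw [Finset.sum_comm]
  refine Finset.sum_congr rfl fun q _ => Finset.sum_congr rfl fun j _ => ?_
  have sgn : ∀ (m : ℕ) (y : KoszulObj V a X), (-1 : ℤ) ^ m • y = (-1 : R) ^ m • y := by
    intro m y
    rcases Nat.even_or_odd m with hm | hm
    · rw [hm.neg_one_pow, hm.neg_one_pow, one_smul, one_smul]
    · rw [hm.neg_one_pow, hm.neg_one_pow, neg_smul, neg_smul (M := KoszulObj V a X),
        one_smul, one_smul]
  rw [sgn, sgn, pow_succ, pow_succ, mul_neg_one, mul_neg_one, neg_smul (M := KoszulObj V a X),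
    neg_smul (M := KoszulObj V a X), smul_neg, smul_neg, neg_neg]
  congr 1
  rw [smul_comm]
  rfl

/-- The `FI`-module `S̃_{-a} V`. -/
noncomputable def koszul (V : FIModule R) (a : ℕ) : FIModule R where
  obj X := ModuleCat.of R (KoszulObj V a X)
  map α := ModuleCat.ofHom (koszulMap V a α)
  map_id X := by rw [koszulMap_id]; rfl
  map_comp α β := by rw [koszulMap_comp]; rfl

/-- The differential `S̃_{-(a+1)} V → S̃_{-a} V`. -/
noncomputable def koszulDiff (V : FIModule R) (a : ℕ) : koszul V (a + 1) ⟶ koszul V a where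
  app X := ModuleCat.ofHom (koszulD V a X)
  naturality X Y α := by
    ext x
    exact LinearMap.congr_fun (koszulD_naturality V a α) x

/-- The complex `⋯ → S̃_{-2} V → S̃_{-1} V → S̃_0 V → 0` of `FI`-modules, with `S̃_{-a} V` in
homological degree `a`. -/
noncomputable def koszulComplex (V : FIModule R) : ChainComplex (FIModule R) ℕ :=
  ChainComplex.of (koszul V) (koszulDiff V) fun a => by
    ext X x
    exact LinearMap.congr_fun (koszulD_koszulD V a X) x

end FIModule

/-! Two facts give the theorem. First, an injection `α : X → Y` missing a point `y` acts by zero on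
homology: `h (v ⊗ u) = α(v) ⊗ y ∧ α(u)` satisfies `d h + h d = -α`, so `α` sends cycles to
boundaries (`koszulMap_mem_range`). Second, over a noetherian ring a submodule of a finitely
generated `FI`-module is generated in bounded degree (`exists_generation_bound`).

Each `S̃_{-a} V` is finitely generated, so its cycles in large degree `m` come from cycles on sets
`[m']` with `m' < m`. Injections `[m'] → [m]` are not surjective, so these cycles are boundaries and
the homology at `[m]` vanishes.

The second fact is a Gröbner basis argument. The images of the generators in degree `m` are indexed
by words, ordered compatibly with increasing injections. A submodule has an ideal of leading
coefficients at each word, which grows along such injections. Higman's lemma and the ascending chain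
condition on ideals show that every long word is pushed forward from a shorter one with the same
ideal, so leading terms can be cancelled by elements of smaller degree. -/

/-! ### Words and Higman's lemma -/

/-- Any sequence of injections `Fin n ↪ Fin (m k)` has a subsequence in which each term is
obtained from each earlier one by composition with an increasing injection. -/
theorem exists_subseq_orderEmbedding {n : ℕ} (m : ℕ → ℕ) (f : ∀ k, Fin n ↪ Fin (m k)) :
    ∃ φ : ℕ ↪o ℕ, ∀ i j, i ≤ j →
      ∃ g : Fin (m (φ i)) ↪o Fin (m (φ j)), ∀ t, g (f (φ i) t) = f (φ j) t := by
  classical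
  -- The letter at `x` is the fibre of `f k` over `x`, so the alphabet is finite and Higman's lemma
  -- applies. A subword embedding preserving letters is an increasing `g` that carries fibres to
  -- fibres.
  let word : ℕ → List (Set (Fin n)) := fun k => List.ofFn fun x : Fin (m k) => {t | f k t = x}
  have hpwo : ({l : List (Set (Fin n)) | ∀ x ∈ l, x ∈ (Set.univ : Set (Set (Fin n)))}
      ).PartiallyWellOrderedOn (List.SublistForall₂ Eq) :=
    Set.PartiallyWellOrderedOn.partiallyWellOrderedOn_sublistForall₂ Eq
      Set.finite_univ.partiallyWellOrderedOn
  have : IsPreorder (List (Set (Fin n))) (List.SublistForall₂ Eq) := {}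
  obtain ⟨φ, hφ⟩ := hpwo.exists_monotone_subseq (f := word) fun _ _ _ => Set.mem_univ _
  refine ⟨φ, fun i j hij => ?_⟩
  obtain ⟨l, hl, hsub⟩ := List.sublistForall₂_iff.1 (hφ i j hij)
  rw [List.forall₂_eq_eq_eq] at hl
  subst hl
  obtain ⟨g, hg⟩ := List.sublist_iff_exists_fin_orderEmbedding_get_eq.1 hsub
  have hlen : ∀ k, (word k).length = m k := fun k => List.length_ofFn
  refine ⟨(Fin.castOrderIso (hlen (φ i)).symm).toOrderEmbedding.trans
    (g.trans (Fin.castOrderIso (hlen (φ j))).toOrderEmbedding), fun t => ?_⟩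
  have h := hg (Fin.cast (hlen (φ i)).symm (f (φ i) t))
  have hget : ∀ k (x : Fin (word k).length),
      (word k).get x = {t | f k t = Fin.cast (hlen k) x} := fun k x => by
    simp only [word, List.get_ofFn]
  rw [hget, hget] at h
  have ht : t ∈ {s | f (φ j) s =
      Fin.cast (hlen (φ j)) (g (Fin.cast (hlen (φ i)).symm (f (φ i) t)))} := by
    rw [← h]; rfl
  exact ht.symm

namespace FIModule

variable {R : Type u} [CommRing R]

/-- The words of length `m` for the arities `n`: an index `i` and an injection
`Fin (n i) ↪ Fin m`. -/
abbrev Word {k : ℕ} (n : Fin k → ℕ) (m : ℕ) : Type := Σ i : Fin k, (Fin (n i) ↪ Fin m)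

namespace Word

variable {k : ℕ} {n : Fin k → ℕ} {m m' : ℕ}

/-- A word as an element of a lexicographically ordered set. -/
def key (e : Word n m) : Σₗ i : Fin k, Lex (Fin (n i) → Fin m) :=
  toLex ⟨e.1, toLex (e.2 : Fin (n e.1) → Fin m)⟩

lemma key_injective : Function.Injective (key : Word n m → _) := by
  rintro ⟨i, f⟩ ⟨j, g⟩ h
  have h' : (⟨i, (f : Fin (n i) → Fin m)⟩ : Σ i : Fin k, (Fin (n i) → Fin m)) = ⟨j, g⟩ := h
  obtain ⟨rfl, h''⟩ := Sigma.mk.inj_iff.1 h'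
  rw [DFunLike.coe_injective (eq_of_heq h'')]

/-- Composition of a word with an increasing injection. -/
def push (g : Fin m ↪o Fin m') (e : Word n m) : Word n m' := ⟨e.1, e.2.trans g.toEmbedding⟩

/-- An increasing `g` preserves both the agreement before the first difference and the inequality
there. This makes the order on words a term order. -/
lemma key_push_lt (g : Fin m ↪o Fin m') {e e' : Word n m} (h : e.key < e'.key) :
    (e.push g).key < (e'.push g).key := by
  obtain ⟨i, f⟩ := e
  obtain ⟨j, f'⟩ := e'
  rcases Sigma.Lex.lt_def.1 h with h | ⟨h, h'⟩
  · exact Sigma.Lex.lt_def.2 (Or.inl h)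
  · obtain rfl : i = j := h
    obtain ⟨t, ht, ht'⟩ : ∃ t, (∀ s < t, f s = f' s) ∧ f t < f' t := h'
    refine Sigma.Lex.lt_def.2 (Or.inr ⟨rfl, ⟨t, fun s hs => ?_, ?_⟩⟩)
    · exact congrArg g (ht s hs)
    · exact g.lt_iff_lt.2 ht'

end Word

/-! ### Leading terms -/

section LeadingTerms

variable (W : FIModule R) {k : ℕ} {n : Fin k → ℕ} (w : ∀ i, W.obj (FI.std (n i)))

/-- The element of `W([m])` given by a word. -/
def wordElt {m : ℕ} (e : Word n m) : W.obj (FI.std m) :=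
  W.act (FI.ofEmb (X := FI.std (n e.1)) (Y := FI.std m) e.2) (w e.1)

/-- The span of the words smaller than `e`. -/
def lowerSpan {m : ℕ} (e : Word n m) : Submodule R (W.obj (FI.std m)) :=
  Submodule.span R {x | ∃ e' : Word n m, e'.key < e.key ∧ W.wordElt w e' = x}

/-- The ideal of leading coefficients at the word `e` of the elements of `K`. -/
def leadIdeal (K : ∀ X, Submodule R (W.obj X)) {m : ℕ} (e : Word n m) : Ideal R :=
  (K (FI.std m) ⊔ W.lowerSpan w e).comap (LinearMap.toSpanSingleton R _ (W.wordElt w e))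

lemma mem_leadIdeal {K : ∀ X, Submodule R (W.obj X)} {m : ℕ} {e : Word n m} {r : R} :
    r ∈ W.leadIdeal w K e ↔ r • W.wordElt w e ∈ K (FI.std m) ⊔ W.lowerSpan w e :=
  Iff.rfl

/-- An increasing injection as a morphism of `FI`. -/
def incMap {m m' : ℕ} (g : Fin m ↪o Fin m') : FI.std m ⟶ FI.std m' :=
  FI.ofEmb (X := FI.std m) (Y := FI.std m') g.toEmbedding

lemma act_wordElt {m m' : ℕ} (g : Fin m ↪o Fin m') (e : Word n m) :
    W.act (incMap g) (W.wordElt w e) = W.wordElt w (e.push g) :=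
  W.act_act _ _ _

lemma act_mem_lowerSpan {m m' : ℕ} (g : Fin m ↪o Fin m') (e : Word n m)
    {x : W.obj (FI.std m)} (hx : x ∈ W.lowerSpan w e) :
    W.act (incMap g) x ∈ W.lowerSpan w (e.push g) := by
  suffices h : W.lowerSpan w e ≤ (W.lowerSpan w (e.push g)).comap (W.act (incMap g)) from h hx
  refine Submodule.span_le.2 ?_
  rintro _ ⟨e', he', rfl⟩
  exact Submodule.subset_span ⟨e'.push g, Word.key_push_lt g he', (W.act_wordElt w g e').symm⟩

/-- Applying `g` to `r • e = y + l`, with `y` in `K` and `l` a combination of smaller words, gives a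
relation of the same kind at `e.push g`. -/
lemma leadIdeal_le_push {K : ∀ X, Submodule R (W.obj X)}
    (hK : ∀ (X Y : FI) (α : X ⟶ Y), ∀ x ∈ K X, W.act α x ∈ K Y) {m m' : ℕ}
    (g : Fin m ↪o Fin m') (e : Word n m) :
    W.leadIdeal w K e ≤ W.leadIdeal w K (e.push g) := by
  intro r hr
  rw [mem_leadIdeal] at hr ⊢
  obtain ⟨y, hy, l, hl, h⟩ := Submodule.mem_sup.1 hr
  rw [← act_wordElt, ← map_smul, ← h, map_add]
  exact Submodule.add_mem_sup (hK _ _ _ _ hy) (W.act_mem_lowerSpan w g e hl)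

/-- Every long enough word is obtained from a shorter one with the same ideal of leading
coefficients. -/
lemma exists_shorter_word [IsNoetherianRing R] {K : ∀ X, Submodule R (W.obj X)}
    (hK : ∀ (X Y : FI) (α : X ⟶ Y), ∀ x ∈ K X, W.act α x ∈ K Y) :
    ∃ N, ∀ m > N, ∀ e : Word n m, ∃ m' < m, ∃ (g : Fin m' ↪o Fin m) (e' : Word n m'),
      e'.push g = e ∧ W.leadIdeal w K e ≤ W.leadIdeal w K e' := by
  suffices h : ∀ i : Fin k, ∃ N, ∀ m > N, ∀ f : Fin (n i) ↪ Fin m, ∃ m' < m,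
      ∃ (g : Fin m' ↪o Fin m) (f' : Fin (n i) ↪ Fin m'), Word.push g (⟨i, f'⟩ : Word n m') = ⟨i, f⟩ ∧
        W.leadIdeal w K (⟨i, f⟩ : Word n m) ≤ W.leadIdeal w K (⟨i, f'⟩ : Word n m') by
    choose N hN using h
    refine ⟨Finset.univ.sup N, fun m hm ⟨i, f⟩ => ?_⟩
    obtain ⟨m', hm', g, f', h⟩ :=
      hN i m (lt_of_le_of_lt (Finset.le_sup (f := N) (Finset.mem_univ i)) hm) f
    exact ⟨m', hm', g, ⟨i, f'⟩, h⟩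
  intro i
  -- A counterexample for every bound `N` yields words `f N` of length `m N > N`. Along a Higman
  -- subsequence their ideals form an ascending chain.
  by_contra! hcon
  choose m hm f hbad using hcon
  obtain ⟨φ, hφ⟩ := exists_subseq_orderEmbedding m f
  have push_eq : ∀ {a b : ℕ} (g : Fin (m a) ↪o Fin (m b)), (∀ t, g (f a t) = f b t) →
      Word.push g (⟨i, f a⟩ : Word n (m a)) = ⟨i, f b⟩ := fun g hg =>
    congrArg (Sigma.mk i) (Function.Embedding.ext hg)
  let J : ℕ →o Ideal R := ⟨fun j => W.leadIdeal w K (⟨i, f (φ j)⟩ : Word n (m (φ j))), by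
    intro a b hab
    obtain ⟨g, hg⟩ := hφ a b hab
    have := W.leadIdeal_le_push w hK g (⟨i, f (φ a)⟩ : Word n (m (φ a)))
    rwa [push_eq g hg] at this⟩
  obtain ⟨s, hs⟩ := monotone_stabilizes_iff_noetherian.2 ‹IsNoetherianRing R› J
  -- `j ≥ s` puts the ideal in the stable range, and `j ≥ m (φ s)` makes the later word strictly
  -- longer, since `m (φ j) > φ j ≥ j`.
  let j := max s (m (φ s))
  obtain ⟨g, hg⟩ := hφ s j (le_max_left _ _)
  have hlt : m (φ s) < m (φ j) :=
    lt_of_le_of_lt ((le_max_right s (m (φ s))).trans φ.strictMono.le_apply) (hm (φ j))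
  exact hbad (φ j) (m (φ s)) hlt g (f (φ s)) (push_eq g hg) (hs j (le_max_left _ _)).ge

/-- **Noetherianity.** A sub-`FI`-module `K` of a finitely generated `FI`-module over a noetherian
ring is generated in bounded degree. -/
theorem exists_generation_bound [IsNoetherianRing R] (hW : W.FinitelyGenerated)
    {K : ∀ X, Submodule R (W.obj X)}
    (hK : ∀ (X Y : FI) (α : X ⟶ Y), ∀ x ∈ K X, W.act α x ∈ K Y) :
    ∃ N, ∀ m > N, ∀ P : Submodule R (W.obj (FI.std m)),
      (∀ m' < m, ∀ α : FI.std m' ⟶ FI.std m, ∀ y ∈ K (FI.std m'), W.act α y ∈ P) →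
        K (FI.std m) ≤ P := by
  obtain ⟨k, n, w, hw⟩ := hW
  obtain ⟨N, hN⟩ := W.exists_shorter_word w hK
  refine ⟨N, fun m hm P hP => ?_⟩
  -- Division step: the largest word `e` of `A` can be removed from any element of `K` in the span
  -- of `A` by subtracting an element of `P`, which leaves an element of `K` in `lowerSpan e`.
  have hlower : ∀ A : Set (Word n m), (∀ e ∈ A, K (FI.std m) ⊓ W.lowerSpan w e ≤ P) →
      K (FI.std m) ⊓ Submodule.span R (W.wordElt w '' A) ≤ P := by
    intro A hA
    rcases A.eq_empty_or_nonempty with rfl | hne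
    · simp
    obtain ⟨e, heA, hmax⟩ := Set.exists_max_image A Word.key A.toFinite hne
    rintro x ⟨hxK, hx⟩
    have hx' : x ∈ Submodule.span R {W.wordElt w e} ⊔ W.lowerSpan w e := by
      refine Submodule.span_le.2 ?_ hx
      rintro _ ⟨e', he', rfl⟩
      rcases (hmax e' he').lt_or_eq with h | h
      · exact Submodule.mem_sup_right (Submodule.subset_span ⟨e', h, rfl⟩)
      · rw [Word.key_injective h]
        exact Submodule.mem_sup_left (Submodule.mem_span_singleton_self _)
    obtain ⟨y, hy, l, hl, rfl⟩ := Submodule.mem_sup.1 hx'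
    obtain ⟨r, rfl⟩ := Submodule.mem_span_singleton.1 hy
    obtain ⟨m', hm', g, e', rfl, hJ⟩ := hN m hm e
    have hr : r ∈ W.leadIdeal w K (e'.push g) := by
      rw [mem_leadIdeal, ← add_sub_cancel_right (r • _) l]
      exact Submodule.sub_mem _ (Submodule.mem_sup_left hxK) (Submodule.mem_sup_right hl)
    -- `z` is an element of `K` in degree `m' < m` with leading term `r • e'`; its image under `g`
    -- lies in `P` and has leading term `r • e`.
    obtain ⟨z, hz, l', hl', h⟩ := Submodule.mem_sup.1 ((W.mem_leadIdeal w).1 (hJ hr))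
    have hdiff : r • W.wordElt w (e'.push g) + l =
        W.act (incMap g) z + (W.act (incMap g) l' + l) := by
      rw [← act_wordElt, ← map_smul, ← h, map_add, add_assoc]
    have hzP := hP m' hm' (incMap g) z hz
    have hzK := hK _ _ (incMap g) z hz
    rw [hdiff] at hxK ⊢
    refine P.add_mem hzP (hA _ heA ⟨(Submodule.add_mem_iff_right _ hzK).1 hxK, ?_⟩)
    exact Submodule.add_mem _ (W.act_mem_lowerSpan w g e' hl') hl
  -- `lowerSpan e` is itself the span of a set of words, all smaller than `e`, so `hlower` also
  -- drives the induction.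
  have hall : ∀ e : Word n m, K (FI.std m) ⊓ W.lowerSpan w e ≤ P := by
    intro e
    induction e using (InvImage.wf (Word.key : Word n m → _)
      (Finite.wellFounded_of_trans_of_irrefl (· < ·))).induction with
    | _ e ih =>
      exact hlower {e' | e'.key < e.key} ih
  have htop : Submodule.span R (W.wordElt w '' (Set.univ : Set (Word n m))) = ⊤ := by
    rw [eq_top_iff, ← hw (FI.std m)]
    refine Submodule.span_mono ?_
    rintro _ ⟨i, α, rfl⟩
    exact ⟨⟨i, FI.emb α⟩, trivial, rfl⟩
  have := hlower Set.univ fun e _ => hall e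
  rwa [htop, inf_top_eq] at this

end LeadingTerms
/-! ### Finite generation of the terms of the complex -/

/-- The last `a` elements of `[n + a]`. -/
def lastSubset (n a : ℕ) : Subsets (FI.std (n + a)) a :=
  ⟨(Finset.univ : Finset (Fin a)).map (Fin.natAddEmb n),
    (Finset.card_map _).trans (Finset.card_fin a)⟩

lemma natAdd_mem_lastSubset (n : ℕ) {a : ℕ} (p : Fin a) :
    (Fin.natAdd n p : FI.std (n + a)) ∈ (lastSubset n a).1 :=
  Finset.mem_map_of_mem (Fin.natAddEmb n) (Finset.mem_univ p)

/-- The inclusion of `[n]` into the complement of the last `a` elements of `[n + a]`. -/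
def firstMap (n a : ℕ) : FI.std n ⟶ (FI.std (n + a)).compl (lastSubset n a).1 :=
  FI.ofEmb (X := FI.std n) ⟨fun j => ⟨(Fin.castAdd (n := n) a j : Fin (n + a)), fun h => by
      obtain ⟨p, -, hp⟩ := Finset.mem_map.1 h
      have h1 : n + Fin.val p = Fin.val (n := n) j := congrArg Fin.val hp
      have h2 := Fin.isLt (n := n) j
      omega⟩,
    fun _ _ h => Fin.castAdd_injective n a (congrArg Subtype.val h)⟩

/-- The map `[n + a] → X` given by a map `[n] → X \ I` and a family in `I`. -/
def joinFun {X : FI} {a n : ℕ} {I : Subsets X a} (f : Fin n → X.compl I.1) (t : Fin a → I.1) :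
    Fin (n + a) → X :=
  Fin.addCases (fun j => (f j).1) (fun p => (t p).1)

lemma joinFun_castAdd {X : FI} {a n : ℕ} {I : Subsets X a} (f : Fin n → X.compl I.1)
    (t : Fin a → I.1) (j : Fin n) : joinFun f t (Fin.castAdd a j) = (f j).1 :=
  Fin.addCases_left j

lemma joinFun_natAdd {X : FI} {a n : ℕ} {I : Subsets X a} (f : Fin n → X.compl I.1)
    (t : Fin a → I.1) (p : Fin a) : joinFun f t (Fin.natAdd n p) = (t p).1 :=
  Fin.addCases_right p

lemma joinFun_injective {X : FI} {a n : ℕ} {I : Subsets X a} {f : Fin n → X.compl I.1}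
    {t : Fin a → I.1} (hf : Function.Injective f) (ht : Function.Injective t) :
    Function.Injective (joinFun f t) := by
  intro x y
  refine Fin.addCases (fun i => ?_) (fun i => ?_) x <;>
    refine Fin.addCases (fun j => ?_) (fun j => ?_) y <;>
    simp only [joinFun_castAdd, joinFun_natAdd] <;> intro h
  · exact congrArg _ (hf (Subtype.ext h))
  · exact absurd (h ▸ (t j).2) (f i).2
  · exact absurd (h ▸ (t i).2) (f j).2
  · exact congrArg _ (ht (Subtype.ext h))

/-- The injection `[n + a] → X` given by an injection `[n] → X \ I` and an enumeration
of `I`. -/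
def joinMap {X : FI} {a n : ℕ} {I : Subsets X a} (α : FI.std n ⟶ X.compl I.1) (t : Fin a → I.1)
    (ht : Function.Injective t) : FI.std (n + a) ⟶ X :=
  FI.ofEmb (X := FI.std (n + a)) (Y := X) ⟨joinFun (FI.emb α) t,
    joinFun_injective (FI.emb α).injective ht⟩

lemma joinMap_castAdd {X : FI} {a n : ℕ} {I : Subsets X a} (α : FI.std n ⟶ X.compl I.1)
    (t : Fin a → I.1) (ht : Function.Injective t) (j : Fin n) :
    FI.emb (joinMap α t ht) (Fin.castAdd a j : Fin (n + a)) = (FI.emb α j).1 :=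
  joinFun_castAdd _ t j

lemma joinMap_natAdd {X : FI} {a n : ℕ} {I : Subsets X a} (α : FI.std n ⟶ X.compl I.1)
    (t : Fin a → I.1) (ht : Function.Injective t) (p : Fin a) :
    FI.emb (joinMap α t ht) (Fin.natAdd n p : Fin (n + a)) = (t p).1 :=
  joinFun_natAdd _ t p

lemma lastSubset_map_joinMap {X : FI} {a n : ℕ} {I : Subsets X a} (α : FI.std n ⟶ X.compl I.1)
    (t : Fin a → I.1) (ht : Function.Injective t) :
    (lastSubset n a).map (joinMap α t ht) = I := by
  refine Subtype.ext (Finset.eq_of_subset_of_card_le (fun x hx => ?_) ?_)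
  · obtain ⟨y, hy, rfl⟩ := Finset.mem_map.1 hx
    obtain ⟨p, -, rfl⟩ := Finset.mem_map.1 hy
    exact (joinMap_natAdd α t ht p).symm ▸ (t p).2
  · rw [I.2, ((lastSubset n a).map (joinMap α t ht)).2]

lemma freeMap_single {X Y : FI} (α : X ⟶ Y) {I : Finset X}
    {J : Finset Y} (h : ∀ x ∈ I, FI.emb α x ∈ J) (x : I) (r : R) :
    freeMap R α h (Finsupp.single x r) = Finsupp.single ⟨FI.emb α x.1, h x.1 x.2⟩ r :=
  Finsupp.mapDomain_single

/-- The element `v ⊗ (n + 1) ∧ ⋯ ∧ (n + a)` of `(S̃_{-a} V)([n + a])`. -/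
noncomputable def koszulGen (V : FIModule R) {n : ℕ} (a : ℕ) (v : V.obj (FI.std n)) :
    KoszulObj V a (FI.std (n + a)) :=
  incl V (lastSubset n a) (V.act (firstMap n a) v ⊗ₜ exteriorPower.ιMulti R a fun p =>
    Finsupp.single ⟨Fin.natAdd n p, natAdd_mem_lastSubset n p⟩ 1)

/-- Gluing `α` with an enumeration `t` of `I` gives one injection `[n + a] → X` that carries the
last `a` points to `I`. Every generating tensor thus comes from some `koszulGen`. -/
lemma koszulMap_koszulGen (V : FIModule R) {X : FI} {a n : ℕ} {I : Subsets X a}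
    (α : FI.std n ⟶ X.compl I.1) (t : Fin a → I.1) (ht : Function.Injective t)
    (v : V.obj (FI.std n)) :
    koszulMap V a (joinMap α t ht) (koszulGen V a v) =
      incl V I (V.act α v ⊗ₜ exteriorPower.ιMulti R a fun p => Finsupp.single (t p) 1) := by
  rw [koszulGen, koszulMap_incl]
  refine incl_congr V (lastSubset_map_joinMap α t ht) ?_ fun p x hx => ?_
  · rw [act_act, act_act]
    congr 2
    exact FI.hom_ext fun j => Subtype.ext (joinMap_castAdd α t ht j)
  · rw [freeMap_single, Finsupp.single_apply, Finsupp.single_apply]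
    simp only [Subtype.ext_iff, joinMap_natAdd]

/-- If `V` is finitely generated, then so is `S̃_{-a} V`. -/
theorem FinitelyGenerated.koszul {V : FIModule R} (hV : V.FinitelyGenerated) (a : ℕ) :
    (koszul V a).FinitelyGenerated := by
  obtain ⟨k, n, w, hw⟩ := hV
  refine ⟨k, fun i => n i + a, fun i => koszulGen V a (w i), fun X => ?_⟩
  set S : Submodule R (KoszulObj V a X) := Submodule.span R
    {x | ∃ (i : Fin k) (α : FI.std (n i + a) ⟶ X), koszulMap V a α (koszulGen V a (w i)) = x}
  suffices h : S.mkQ = 0 by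
    have h' : S = ⊤ := by rw [← Submodule.ker_mkQ S, h, LinearMap.ker_zero]
    exact h'
  refine DirectSum.linearMap_ext R fun I => TensorProduct.ext' fun v x => ?_
  have : S.mkQ ∘ₗ incl V I ∘ₗ TensorProduct.mk R _ _ v = 0 := by
    -- An alternating map is determined by injective families `t` of basis vectors, which is what
    -- `joinMap` needs.
    refine exteriorPower.linearMap_ext
      (Module.Basis.ext_alternating Finsupp.basisSingleOne fun t ht => ?_)
    simp only [Finsupp.coe_basisSingleOne]
    have hker : (⊤ : Submodule R (V.obj (X.compl I.1))) ≤ LinearMap.ker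
        (S.mkQ ∘ₗ incl V I ∘ₗ (TensorProduct.mk R _ (Det R I)).flip
          (exteriorPower.ιMulti R a fun p => Finsupp.single (t p) 1)) := by
      rw [← hw, Submodule.span_le]
      rintro _ ⟨i, α, rfl⟩
      refine (Submodule.Quotient.mk_eq_zero S).2 (Submodule.subset_span ⟨i, joinMap α t ht, ?_⟩)
      exact koszulMap_koszulGen V α t ht (w i)
    exact hker (Submodule.mem_top (x := v))
  exact LinearMap.congr_fun this x

/-! ### The homotopy -/

section Homotopy

variable {X Y : FI} (α : X ⟶ Y) {y : Y} (hy : ∀ x, FI.emb α x ≠ y)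

/-- The subset `α(I) ∪ {y}`, for `y` outside of the image of `α`. -/
noncomputable def Subsets.insertMap {a : ℕ} (I : Subsets X a) : Subsets Y (a + 1) :=
  ⟨insert y (I.map α).1, by
    rw [Finset.card_insert_of_notMem, (I.map α).2]
    intro h
    obtain ⟨x, -, hx⟩ := Finset.mem_map.1 h
    exact hy x hx⟩

variable {α} {a : ℕ} (I : Subsets X a)

lemma Subsets.mem_insertMap_self : y ∈ (I.insertMap α hy).1 := Finset.mem_insert_self _ _

lemma Subsets.emb_mem_insertMap {x : X} : FI.emb α x ∈ (I.insertMap α hy).1 ↔ x ∈ I.1 :=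
  ⟨fun h => (I.emb_mem_map α).1 ((Finset.mem_insert.1 h).resolve_left (hy x)),
    fun h => Finset.mem_insert_of_mem ((I.emb_mem_map α).2 h)⟩

/-- The elements of `α(I) ∪ {y}`. -/
noncomputable def Subsets.insertEquiv : Option I.1 ≃ (I.insertMap α hy).1 :=
  Equiv.ofBijective
    (fun o => o.elim ⟨y, I.mem_insertMap_self hy⟩
      fun x => ⟨FI.emb α x.1, (I.emb_mem_insertMap hy).2 x.2⟩) (by
    constructor
    · rintro (_ | x) (_ | x') h
      · rfl
      · exact absurd (congrArg Subtype.val h).symm (hy _)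
      · exact absurd (congrArg Subtype.val h) (hy _)
      · exact congrArg some (Subtype.ext ((FI.emb α).injective (congrArg Subtype.val h)))
    · rintro ⟨z, hz⟩
      rcases Finset.mem_insert.1 hz with rfl | h
      · exact ⟨none, rfl⟩
      · obtain ⟨x, hx, rfl⟩ := Finset.mem_map.1 h
        exact ⟨some ⟨x, hx⟩, rfl⟩)

lemma Subsets.insertEquiv_some (x : I.1) :
    I.insertEquiv hy (some x) = ⟨FI.emb α x.1, (I.emb_mem_insertMap hy).2 x.2⟩ := rfl

variable (R) in
/-- The map `det I → det (α(I) ∪ {y})`, `u ↦ y ∧ α(u)`. -/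
noncomputable def wedgePoint : Det R I →ₗ[R] Det R (I.insertMap α hy) :=
  exteriorPower.alternatingMapLinearEquiv
    (((exteriorPower.ιMulti R (a + 1)).curryLeft
      (Finsupp.single ⟨y, I.mem_insertMap_self hy⟩ 1)).compLinearMap
        (freeMap R α fun _ hx => (I.emb_mem_insertMap hy).2 hx))

/-- The family `y, α(w₁), …, α(w_a)`. -/
noncomputable def consPoint (w : Fin a → (I.1 →₀ R)) :
    Fin (a + 1) → ((I.insertMap α hy).1 →₀ R) :=
  Fin.cons (Finsupp.single ⟨y, I.mem_insertMap_self hy⟩ 1)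
    fun p => freeMap R α (fun _ hx => (I.emb_mem_insertMap hy).2 hx) (w p)

lemma wedgePoint_ιMulti (w : Fin a → (I.1 →₀ R)) :
    wedgePoint R hy I (exteriorPower.ιMulti R a w) =
      exteriorPower.ιMulti R (a + 1) (consPoint hy I w) := by
  rw [wedgePoint, exteriorPower.alternatingMapLinearEquiv_apply_ιMulti]
  rfl

/-- The map `(S̃_{-a} V)(X) → (S̃_{-(a+1)} V)(Y)`, `v ⊗ u ↦ α(v) ⊗ y ∧ α(u)`. -/
noncomputable def koszulHomotopy (a : ℕ) (V : FIModule R) :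
    KoszulObj V a X →ₗ[R] KoszulObj V (a + 1) Y :=
  DirectSum.toModule R _ _ fun I =>
    incl V (I.insertMap α hy) ∘ₗ
      TensorProduct.map
        (V.act (FI.complMap α fun _ hx => (I.emb_mem_insertMap hy).not.2 hx))
        (wedgePoint R hy I)

lemma koszulHomotopy_incl (V : FIModule R) (v : V.obj (X.compl I.1)) (w : Fin a → (I.1 →₀ R)) :
    koszulHomotopy hy a V (incl V I (v ⊗ₜ exteriorPower.ιMulti R a w)) =
      incl V (I.insertMap α hy)
        (V.act (FI.complMap α fun _ hx => (I.emb_mem_insertMap hy).not.2 hx) v ⊗ₜ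
          exteriorPower.ιMulti R (a + 1) (consPoint hy I w)) := by
  rw [← wedgePoint_ιMulti]
  simp [koszulHomotopy, incl]

lemma freeMap_apply_point (w : I.1 →₀ R) :
    freeMap R α (fun _ hx => (I.emb_mem_insertMap hy).2 hx) w ⟨y, I.mem_insertMap_self hy⟩ = 0 := by
  refine Finsupp.mapDomain_of_notMem_range _ _ ?_
  rintro ⟨x, hx⟩
  exact hy x.1 (congrArg Subtype.val hx)

/-- Removing `y`, the first factor, gives `-α`. Removing a point `α(x)` gives the sum, which is to
cancel against `h d`. -/
lemma koszulD_koszulHomotopy_incl (V : FIModule R) (v : V.obj (X.compl I.1))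
    (w : Fin a → (I.1 →₀ R)) :
    koszulD V a Y (koszulHomotopy hy a V (incl V I (v ⊗ₜ exteriorPower.ιMulti R a w))) =
      -koszulMap V a α (incl V I (v ⊗ₜ exteriorPower.ιMulti R a w)) +
        ∑ x : I.1, ∑ q : Fin a, (-1 : R) ^ (q.1 + 2) • w q x •
          incl V ((I.insertMap α hy).erase ⟨FI.emb α x.1, (I.emb_mem_insertMap hy).2 x.2⟩)
            (V.actIncl ((I.insertMap α hy).erase_subset _)
              (V.act (FI.complMap α fun _ hx => (I.emb_mem_insertMap hy).not.2 hx) v) ⊗ₜ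
                exteriorPower.ιMulti R a fun s =>
                  freeProj R ((I.insertMap α hy).erase_subset _)
                    (q.succ.removeNth (consPoint hy I w) s)) := by
  rw [koszulHomotopy_incl, koszulD_incl_ιMulti, ← (I.insertEquiv hy).sum_comp,
    Fintype.sum_option]
  congr 1
  -- The vectors `α(w_p)` have no `y`-coordinate, so only the head of the family contributes.
  · rw [Fin.sum_univ_succ, Finset.sum_eq_zero, add_zero, koszulMap_incl]
    · have h1 : consPoint hy I w 0 (I.insertEquiv hy none) = 1 := Finsupp.single_eq_same
      rw [h1, one_smul, Fin.val_zero, zero_add, pow_one, neg_smul (M := KoszulObj V a Y), one_smul]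
      congr 1
      refine incl_congr V (Subtype.ext (Finset.erase_insert fun h => ?_)) ?_ fun p z hz => ?_
      · obtain ⟨x, -, hx⟩ := Finset.mem_map.1 h
        exact hy x hx
      · rw [actIncl, act_act, act_act]
        rfl
      · obtain ⟨hz1, hz2⟩ := Finset.mem_erase.1 hz
        obtain ⟨x, hx, rfl⟩ := Finset.mem_map.1 (Finset.mem_of_mem_insert_of_ne hz2 hz1)
        rw [freeProj_apply]
        refine (freeMap_apply α _ (w p) x hx).trans ?_
        exact (freeMap_apply α _ (w p) x hx).symm
    · intro q _
      have h0 : consPoint hy I w q.succ (I.insertEquiv hy none) = 0 :=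
        freeMap_apply_point hy I (w q)
      rw [h0, zero_smul, smul_zero]
  -- Here the head contributes nothing, and `w q` sits at position `q + 1`; hence the exponent `q +
  -- 2`.
  · refine Finset.sum_congr rfl fun x _ => ?_
    rw [Subsets.insertEquiv_some, Fin.sum_univ_succ]
    have h0 : consPoint hy I w 0 ⟨FI.emb α x.1, (I.emb_mem_insertMap hy).2 x.2⟩ = 0 :=
      Finsupp.single_eq_of_ne fun h => hy x.1 (congrArg Subtype.val h)
    have h1 (q : Fin a) : consPoint hy I w q.succ
        ⟨FI.emb α x.1, (I.emb_mem_insertMap hy).2 x.2⟩ = w q x :=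
      freeMap_apply α _ (w q) x.1 x.2
    simp only [h0, h1, zero_smul, smul_zero, zero_add, Fin.val_succ, add_assoc]

lemma koszulD_koszulHomotopy_zero (V : FIModule R) (z : KoszulObj V 0 X) :
    koszulD V 0 Y (koszulHomotopy hy 0 V z) = -koszulMap V 0 α z := by
  have : koszulD V 0 Y ∘ₗ koszulHomotopy hy 0 V = -koszulMap V 0 α := by
    refine koszulObj_ext V fun I v w => ?_
    rw [LinearMap.comp_apply, koszulD_koszulHomotopy_incl]
    simp
  exact LinearMap.congr_fun this z

/-- The leading factor `y` shifts every other position by one, so the remaining terms of `d h` and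
those of `h d` have opposite signs and cancel in pairs. -/
lemma koszulD_koszulHomotopy_succ (V : FIModule R) (z : KoszulObj V (a + 1) X) :
    koszulD V (a + 1) Y (koszulHomotopy hy (a + 1) V z) +
      koszulHomotopy hy a V (koszulD V a X z) = -koszulMap V (a + 1) α z := by
  have : koszulD V (a + 1) Y ∘ₗ koszulHomotopy hy (a + 1) V +
      koszulHomotopy hy a V ∘ₗ koszulD V a X = -koszulMap V (a + 1) α := by
    refine koszulObj_ext V fun I v w => ?_
    rw [LinearMap.add_apply, LinearMap.comp_apply, LinearMap.comp_apply,
      koszulD_koszulHomotopy_incl, koszulD_incl_ιMulti, LinearMap.neg_apply, add_assoc]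
    refine add_eq_left.2 ?_
    simp only [map_sum, map_smul, koszulHomotopy_incl]
    rw [← Finset.sum_add_distrib]
    refine Finset.sum_eq_zero fun x _ => ?_
    rw [← Finset.sum_add_distrib]
    refine Finset.sum_eq_zero fun q _ => ?_
    rw [pow_succ, mul_neg_one, neg_smul (M := KoszulObj V (a + 1) Y), neg_add_eq_zero]
    congr 2
    have hset : (I.insertMap α hy).erase ⟨FI.emb α x.1, (I.emb_mem_insertMap hy).2 x.2⟩ =
        (I.erase x).insertMap α hy := by
      refine Subtype.ext ?_
      refine (Finset.erase_insert_of_ne (hy x.1).symm).trans ?_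
      exact congrArg (insert y) (Finset.map_erase (FI.emb α) I.1 x.1).symm
    refine incl_congr V hset ?_ fun p z hz => ?_
    · rw [actIncl, actIncl, act_act, act_act, act_act]
      rfl
    · rw [freeProj_apply]
      -- The entries are compared separately for the factor `y` and for the factors `α(w_s)`. The
      -- latter vanish at `y` on both sides.
      refine Fin.cases ?_ (fun s => ?_) p
      · change Finsupp.single _ _ _ = Finsupp.single _ _ _
        rw [Finsupp.single_apply, Finsupp.single_apply]
        simp only [Subtype.ext_iff]
      · have hs : q.succ.removeNth (consPoint hy I w) s.succ =
            freeMap R α (fun _ hx => (I.emb_mem_insertMap hy).2 hx) (q.removeNth w s) := by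
          simp only [Fin.removeNth, Fin.succ_succAbove_succ]
          rfl
        rw [hs]
        change _ = freeMap R α _ (freeProj R _ (q.removeNth w s)) _
        obtain ⟨hz1, hz2⟩ := Finset.mem_erase.1 hz
        rcases Finset.mem_insert.1 hz2 with rfl | h
        · rw [freeMap_apply_point hy I]
          exact (freeMap_apply_point hy (I.erase x) _).symm
        · obtain ⟨x', hx', rfl⟩ := Finset.mem_map.1 h
          have hx'' : x' ∈ (I.erase x).1 :=
            Finset.mem_erase.2 ⟨fun h => hz1 (congrArg (FI.emb α) h), hx'⟩
          refine (freeMap_apply α _ _ x' hx').trans ?_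
          exact (freeMap_apply α _ (freeProj R (I.erase_subset x) _) x' hx'').symm
  exact LinearMap.congr_fun this z

end Homotopy
/-! ### Vanishing of the homology in large degrees -/

/-- The cycles of `(S̃_{-a} V)(X)`. -/
noncomputable def koszulCycles (V : FIModule R) :
    ∀ (a : ℕ) (X : FI), Submodule R ((koszul V a).obj X)
  | 0, _ => ⊤
  | a + 1, X => LinearMap.ker (koszulD V a X)

lemma act_mem_koszulCycles (V : FIModule R) (a : ℕ) (X Y : FI) (α : X ⟶ Y) :
    ∀ x ∈ koszulCycles V a X, (koszul V a).act α x ∈ koszulCycles V a Y := by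
  intro x hx
  cases a with
  | zero => trivial
  | succ a =>
    have hx' : koszulD V a X x = 0 := hx
    refine (LinearMap.congr_fun (koszulD_naturality V a α) x).trans ?_
    exact (congrArg (koszulMap V a α) hx').trans (map_zero _)

/-- A map which is not surjective sends cycles to boundaries. -/
lemma koszulMap_mem_range (V : FIModule R) {a : ℕ} {X Y : FI} {α : X ⟶ Y} {y : Y}
    (hy : ∀ x, FI.emb α x ≠ y) {z : KoszulObj V a X} (hz : z ∈ koszulCycles V a X) :
    koszulMap V a α z ∈ LinearMap.range (koszulD V a Y) := by
  refine ⟨-koszulHomotopy hy a V z, ?_⟩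
  rw [map_neg, neg_eq_iff_eq_neg]
  cases a with
  | zero => exact koszulD_koszulHomotopy_zero hy V z
  | succ a =>
    have hz' : koszulD V a X z = 0 := hz
    rw [← koszulD_koszulHomotopy_succ hy V z, hz', map_zero, add_zero]

lemma exists_forall_koszulCycles_le_range [IsNoetherianRing R] {V : FIModule R}
    (hV : V.FinitelyGenerated) (a : ℕ) :
    ∃ N, ∀ m > N, koszulCycles V a (FI.std m) ≤ LinearMap.range (koszulD V a (FI.std m)) := by
  obtain ⟨N, hN⟩ := (koszul V a).exists_generation_bound (hV.koszul a) (act_mem_koszulCycles V a)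
  -- The boundaries play the role of `P`.
  refine ⟨N, fun m hm => hN m hm _ fun m' hm' α z hz => ?_⟩
  obtain ⟨y, hy⟩ : ∃ y, ∀ x, FI.emb α x ≠ y := by
    by_contra! h
    have := Fintype.card_le_of_surjective (α := Fin m') (β := Fin m) (FI.emb α) h
    simp only [Fintype.card_fin] at this
    omega
  exact koszulMap_mem_range V hy hz

/-! ### Objectwise homology and the degree bound -/

lemma koszulComplex_d (V : FIModule R) (a : ℕ) :
    (koszulComplex V).d (a + 1) a = koszulDiff V a :=
  ChainComplex.of_d _ _ _

/-- Evaluation at `X` commutes with homology, so exactness can be checked in `R`-modules. -/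
lemma subsingleton_homology_obj (V : FIModule R) (a : ℕ) (X : FI)
    (h : koszulCycles V a X ≤ LinearMap.range (koszulD V a X)) :
    Subsingleton (((koszulComplex V).homology a).obj X) := by
  let F := (evaluation FI (ModuleCat.{u} R)).obj X
  let S := (koszulComplex V).sc' (a + 1) a ((ComplexShape.down ℕ).next a)
  have hS : (S.map F).Exact := by
    rw [ShortComplex.moduleCat_exact_iff]
    intro z hz
    have hz' : z ∈ koszulCycles V a X := by
      cases a with
      | zero => trivial
      | succ a =>
        have e : (ComplexShape.down ℕ).next (a + 1) = a := ChainComplex.next_nat_succ a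
        -- The target index `next (a + 1)` is replaced by a variable `b` so that the equation with
        -- `a` can be substituted.
        have hg : ∀ b, b = a → (((koszulComplex V).d (a + 1) b).app X).hom z = 0 →
            ((koszulDiff V a).app X).hom z = 0 := by
          rintro _ rfl h
          rwa [koszulComplex_d] at h
        exact hg _ e hz
    obtain ⟨y, hy⟩ := h hz'
    refine ⟨y, ?_⟩
    have : (((koszulComplex V).d (a + 1) a).app X).hom y = z := by
      rw [koszulComplex_d]
      exact hy
    exact this
  have hzero := (ShortComplex.exact_iff_isZero_homology _).1 hS
  have e := (S.mapHomologyIso F).symm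
  have e' := F.mapIso (ShortComplex.homologyMapIso
    ((koszulComplex V).isoSc' (a + 1) a _ (ChainComplex.prev ℕ a) rfl))
  exact ModuleCat.subsingleton_of_isZero (hzero.of_iso (e' ≪≫ e))

lemma degree_lt_top (V : FIModule R) {N : ℕ}
    (h : ∀ m > N, Subsingleton (V.obj (FI.std m))) : V.degree < ⊤ := by
  refine lt_of_le_of_lt (b := ((N : ℕ∞) : WithBot ℕ∞)) (sSup_le ?_) ?_
  · rintro _ ⟨m, hm, rfl⟩
    have : m ≤ N := by
      by_contra! hlt
      exact not_subsingleton _ (h m hlt)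
    exact_mod_cast this
  · exact WithBot.coe_lt_coe.2 (ENat.natCast_lt_top N)

end FIModule

theorem corollary4p1 {R : Type u} [CommRing R] [IsNoetherianRing R] (V : FIModule R)
    (hV : V.FinitelyGenerated) (a : ℕ) : ((FIModule.koszulComplex V).homology a).degree < ⊤ := by
  obtain ⟨N, hN⟩ := FIModule.exists_forall_koszulCycles_le_range hV a
  exact FIModule.degree_lt_top _ fun m hm =>
    FIModule.subsingleton_homology_obj V a (FI.std m) (hN m hm)
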